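/- Let $T>0$, $d,q\in\mathbb{N}$, $x\in\mathbb{R}^d$, and let $b:[0,T]\times\mathbb{R}^d\to\mathbb{R}^d$ and $\sigma:[0,T]\times\mathbb{R}^d\to\mathcal{M}(d\times q)$ be continuous. Let $(\Omega,\mathcal{A},(\mathcal{F}_t)_{t\in[0,T]},\mathbb{P})$ be a filtered probability space carrying a standard $q$-dimensional $\mathcal{F}_t$-Brownian motion $W$ on $[0,T]$, and let $X=(X_t)_{t\in[0,T]}$ be a strong solution of $$dX_t=b(t,X_t)\,dt+\sigma(t,X_t)\,dW_t,\qquad X_0=x.$$ For an integer $m\ge 1$ put $t_k=kT/m$ and $U_k=\sqrt{m/T}\,(W_{kT/m}-W_{(k-1)T/m})$, $k=1,\dots,m$. The Euler scheme with step $T/m$ driven by $W$ is the process $\bar X^{[m]}$ given by $\bar X^{[m]}_0=x$, $$\bar X^{[m]}_{t_{k+1}}=\bar X^{[m]}_{t_k}+\frac Tm\,b(t_k,\bar X^{[m]}_{t_k})+\sqrt{\frac Tm}\,\sigma(t_k,\bar X^{[m]}_{t_k})\,U_{k+1},\qquad 0\le k<m,$$ and $\bar X^{[m]}_t=\bar X^{[m]}_{t_k}$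 for $t\in[t_k,t_{k+1})$. Assume that for every $p\in[1,\infty)$ the Euler scheme converges to $X$ in $L^p(\mathbb{P})$ for the sup-norm over $[0,T]$, i.e. $\sup_{t\in[0,T]}|X_t|\in L^p(\mathbb{P})$ and $\big\|\sup_{t\in[0,T]}|\bar X^{[n]}_t-X_t|\big\|_{L^p(\mathbb{P})}\to0$ as $n\to\infty$. Let $V$ be a real vector space, stable by product, of continuous functions $f:\mathbb{R}^d\to\mathbb{R}$ with polynomial growth, which is characterizing: whenever $Y,Z$ are $\mathbb{R}^d$-valued random vectors on a common probability space such that $f(Y)=f(Z)$ a.s. for every $f\in V$, then $Y=Z$ a.s. Let $R\ge1$ be an integer, and assume that for every $f\in V$ there are real constants $c_1,\dots,c_{R-1}$, not depending on $n$, such that $$\mathbb{E}f(X_T)=\mathbb{E}f(\bar X^{[n]}_T)+\sum_{k=1}^{R-1}\frac{c_k}{n^k}+O(n^{-R})\qquad(n\to\infty).$$ For $1\le r\le R$ let $$\alpha_r=(-1)^{R-r}\frac{r^R}{r!\,(R-r)!},$$ and let $\bar X^{(r)}=\bar X^{[rn]}$ be the Euler scheme with step $T/(rn)$, all $R$ schemes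 being driven by the same Brownian motion $W$. Then for every $f\in V$ the variables $f(X_T)$ and, for $n$ large enough, $f(\bar X^{(r)}_T)$, $1\le r\le R$, are square integrable, and, as $n\to\infty$, $$\mathbb{E}\Big(\sum_{r=1}^R\alpha_r f(\bar X^{(r)}_T)\Big)=\mathbb{E}f(X_T)+O(n^{-R})\qquad\text{and}\qquad \mathrm{Var}\Big(\sum_{r=1}^R\alpha_r f(\bar X^{(r)}_T)\Big)\longrightarrow\mathrm{Var}(f(X_T)).$$ -/

import Mathlib

open MeasureTheory ProbabilityTheory Filter Topology Asymptotics
open scoped ENNReal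

universe u

noncomputable section

namespace RichardsonRomberg

/-- Euclidean space `ℝ^d`. -/
abbrev E (d : ℕ) : Type := EuclideanSpace ℝ (Fin d)

/-- `W` is, on `[0, T]`, a standard `q`-dimensional Brownian motion with respect to the filtration
`F`. Only the values of `F` and `W` at times in `[0, T]` matter. -/
structure IsBrownianMotion {Ω : Type u} {mΩ : MeasurableSpace Ω} {q : ℕ} (T : ℝ)
    (F : Filtration ℝ mΩ) (W : ℝ → Ω → E q) (μ : Measure Ω) : Prop where
  adapted : ∀ t ∈ Set.Icc 0 T, Measurable[F t] (W t)
  zero : ∀ᵐ ω ∂μ, W 0 ω = 0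
  increment_law : ∀ s t : ℝ, 0 ≤ s → s ≤ t → t ≤ T →
    HasLaw (fun ω => W t ω - W s ω) ((stdGaussian (E q)).map (fun z => √(t - s) • z)) μ
  increment_indep : ∀ s t : ℝ, 0 ≤ s → s ≤ t → t ≤ T →
    Indep (MeasurableSpace.comap (fun ω => W t ω - W s ω) inferInstance) (F s) μ
  continuous_paths : ∀ᵐ ω ∂μ, ContinuousOn (fun t => W t ω) (Set.Icc 0 T)

/-- A matrix-valued step process `∑_{k < n} ξ_k 1_{(t_k, t_{k+1}]}` on `[0, T]`, where each `ξ_k` is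
bounded and `F_{t_k}`-measurable. -/
structure StepProcess {Ω : Type u} {mΩ : MeasurableSpace Ω} (d q : ℕ) (T : ℝ)
    (F : Filtration ℝ mΩ) where
  n : ℕ
  time : ℕ → ℝ
  time_mono : Monotone time
  time_mem : ∀ k, time k ∈ Set.Icc 0 T
  coef : ℕ → Ω → Matrix (Fin d) (Fin q) ℝ
  coef_measurable : ∀ k i j, Measurable[F (time k)] (fun ω => coef k ω i j)
  coef_bounded : ∀ k, ∃ C : ℝ, ∀ ω i j, |coef k ω i j| ≤ C

namespace StepProcess

variable {Ω : Type u} {mΩ : MeasurableSpace Ω} {d q : ℕ} {T : ℝ} {F : Filtration ℝ mΩ}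

/-- The value of a step process at time `s`. -/
def val (S : StepProcess d q T F) (s : ℝ) (ω : Ω) : Matrix (Fin d) (Fin q) ℝ :=
  ∑ k ∈ Finset.range S.n,
    (Set.Ioc (S.time k) (S.time (k + 1))).indicator (fun _ => S.coef k ω) s

/-- The elementary stochastic integral
`∫_0^t S dW = ∑_{k < n} ξ_k (W_{t_{k+1} ∧ t} - W_{t_k ∧ t})`. -/
def integral (S : StepProcess d q T F) (W : ℝ → Ω → E q) (t : ℝ) (ω : Ω) : E d :=
  ∑ k ∈ Finset.range S.n,
    Matrix.toEuclideanLin (S.coef k ω)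
      (W (min (S.time (k + 1)) t) ω - W (min (S.time k) t) ω)

end StepProcess

/-- `I` is (a version of) the Itô integral process `t ↦ ∫_0^t H_s dW_s` on `[0, T]`: there are step
processes `S_m` such that `∫_0^T |S_m(s) - H_s|² ds → 0` in probability, with `|·|` the Frobenius
norm, and `sup_{t ∈ [0, T]} |∫_0^t S_m dW - I_t| → 0` in probability. -/
def IsItoIntegral {Ω : Type u} {mΩ : MeasurableSpace Ω} {d q : ℕ} (T : ℝ)
    (F : Filtration ℝ mΩ) (W : ℝ → Ω → E q) (μ : Measure Ω)
    (H : ℝ → Ω → Matrix (Fin d) (Fin q) ℝ) (I : ℝ → Ω → E d) : Prop :=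
  ∃ S : ℕ → StepProcess d q T F,
    (∀ ε : ℝ≥0∞, 0 < ε → Tendsto (fun m => μ {ω | ε ≤ ∫⁻ s in Set.Icc 0 T,
      ENNReal.ofReal (∑ i, ∑ j, ((S m).val s ω i j - H s ω i j) ^ 2)}) atTop (𝓝 0)) ∧
    (∀ ε : ℝ≥0∞, 0 < ε → Tendsto (fun m => μ {ω | ε ≤
      ⨆ t ∈ Set.Icc 0 T, ‖(S m).integral W t ω - I t ω‖ₑ}) atTop (𝓝 0))

/-- `X` is a strong solution on `[0, T]` of `dX_t = b(t, X_t) dt + σ(t, X_t) dW_t`, `X_0 = x`: it has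
continuous paths, satisfies the integral equation, and is adapted to the completed filtration
generated by `W` (each `X_t` is almost surely equal to a `σ(W_s, s ∈ [0, t])`-measurable variable). -/
structure IsStrongSolution {Ω : Type u} {mΩ : MeasurableSpace Ω} {d q : ℕ} (T : ℝ)
    (F : Filtration ℝ mΩ) (W : ℝ → Ω → E q) (μ : Measure Ω)
    (b : ℝ → E d → E d) (σ : ℝ → E d → Matrix (Fin d) (Fin q) ℝ) (x : E d)
    (X : ℝ → Ω → E d) : Prop where
  continuous_paths : ∀ᵐ ω ∂μ, ContinuousOn (fun t => X t ω) (Set.Icc 0 T)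
  adapted : ∀ t ∈ Set.Icc 0 T,
    AEStronglyMeasurable[⨆ s ∈ Set.Icc 0 t, MeasurableSpace.comap (W s) inferInstance] (X t) μ
  integral_eq : ∃ I : ℝ → Ω → E d,
    IsItoIntegral T F W μ (fun s ω => σ s (X s ω)) I ∧
    ∀ᵐ ω ∂μ, ∀ t ∈ Set.Icc 0 T, X t ω = x + (∫ s in (0 : ℝ)..t, b s (X s ω)) + I t ω

/-- The white noise `U_k = √(m/T) (W_{kT/m} - W_{(k-1)T/m})`, `k ≥ 1`, for the step `T/m`. -/
def whiteNoise {Ω : Type u} {q : ℕ} (T : ℝ) (W : ℝ → Ω → E q) (m k : ℕ) (ω : Ω) : E q :=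
  √((m : ℝ) / T) • (W ((k : ℝ) * T / m) ω - W (((k : ℝ) - 1) * T / m) ω)

/-- The Euler scheme with step `T/m` and noise `U`, at the grid points `t_k = kT/m`. -/
def eulerGrid {Ω : Type u} {d q : ℕ} (T : ℝ) (b : ℝ → E d → E d)
    (σ : ℝ → E d → Matrix (Fin d) (Fin q) ℝ) (x : E d) (m : ℕ) (U : ℕ → Ω → E q) :
    ℕ → Ω → E d
  | 0 => fun _ => x
  | k + 1 => fun ω =>
      eulerGrid T b σ x m U k ω
        + (T / m) • b ((k : ℝ) * T / m) (eulerGrid T b σ x m U k ω)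
        + Matrix.toEuclideanLin (σ ((k : ℝ) * T / m) (eulerGrid T b σ x m U k ω))
            (√(T / m) • U (k + 1) ω)

/-- The stepwise constant Brownian Euler scheme with step `T/m`: at time `t ∈ [t_k, t_{k+1})` it
takes the value at the grid point `t_k`; at time `T` it takes the value at `t_m = T`. -/
def euler {Ω : Type u} {d q : ℕ} (T : ℝ) (b : ℝ → E d → E d)
    (σ : ℝ → E d → Matrix (Fin d) (Fin q) ℝ) (x : E d) (W : ℝ → Ω → E q) (m : ℕ)
    (t : ℝ) (ω : Ω) : E d :=
  eulerGrid T b σ x m (whiteNoise T W m) ⌊t * m / T⌋₊ ω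

/-- Convergence of a sequence of processes to `X` in `L^p(μ)` for the sup-norm over `[0, T]`. -/
def TendstoLpSup {Ω : Type u} {mΩ : MeasurableSpace Ω} {d : ℕ} (T : ℝ) (μ : Measure Ω)
    (p : ℝ≥0∞) (Y : ℕ → ℝ → Ω → E d) (X : ℝ → Ω → E d) : Prop :=
  eLpNorm (fun ω => ⨆ t ∈ Set.Icc 0 T, ‖X t ω‖ₑ) p μ < ∞ ∧
  Tendsto (fun n => eLpNorm (fun ω => ⨆ t ∈ Set.Icc 0 T, ‖Y n t ω - X t ω‖ₑ) p μ) atTop (𝓝 0)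

/-- `V` is characterizing for almost sure equality of random vectors. -/
def IsCharacterizing {d : ℕ} (V : Submodule ℝ (E d → ℝ)) : Prop :=
  ∀ (Ω : Type u) [MeasurableSpace Ω] (μ : Measure Ω) (Y Z : Ω → E d),
    IsProbabilityMeasure μ → Measurable Y → Measurable Z →
    (∀ f ∈ V, ∀ᵐ ω ∂μ, f (Y ω) = f (Z ω)) → ∀ᵐ ω ∂μ, Y ω = Z ω

/-- Polynomial growth. -/
def HasPolynomialGrowth {d : ℕ} (f : E d → ℝ) : Prop :=
  ∃ (C : ℝ) (m : ℕ), ∀ y, |f y| ≤ C * (1 + ‖y‖ ^ m)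

/-- The expansion of order `R` of the weak error on `V`: for each `f ∈ V` there are constants `c_k`
with `𝔼 f(Z) = 𝔼 f(Y_n) + ∑_{k=1}^{R-1} c_k n^{-k} + O(n^{-R})` as `n → ∞`. -/
def HasWeakExpansion {Ω : Type u} {mΩ : MeasurableSpace Ω} {d : ℕ} (μ : Measure Ω)
    (V : Submodule ℝ (E d → ℝ)) (R : ℕ) (Y : ℕ → Ω → E d) (Z : Ω → E d) : Prop :=
  ∀ f ∈ V, ∃ c : ℕ → ℝ,
    (fun n : ℕ => (∫ ω, f (Z ω) ∂μ) - (∫ ω, f (Y n ω) ∂μ)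
      - ∑ k ∈ Finset.Icc 1 (R - 1), c k / (n : ℝ) ^ k)
      =O[atTop] fun n : ℕ => ((n : ℝ) ^ R)⁻¹

/-- The weights `α_r = (-1)^{R-r} r^R / (r! (R-r)!)`, for `1 ≤ r ≤ R`. -/
def weight (R r : ℕ) : ℝ :=
  (-1) ^ (R - r) * (r : ℝ) ^ R / ((r.factorial : ℝ) * ((R - r).factorial : ℝ))

/-- The combination `∑_{r=1}^R α_r f(X̄^{(r)}_T)`, where `X̄^{(r)}` is the Euler scheme with step
`T/(rn)`, all `R` schemes being driven by the same Brownian motion `W`. -/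
def multistep {Ω : Type u} {d q : ℕ} (T : ℝ) (b : ℝ → E d → E d)
    (σ : ℝ → E d → Matrix (Fin d) (Fin q) ℝ) (x : E d) (W : ℝ → Ω → E q)
    (R : ℕ) (f : E d → ℝ) (n : ℕ) (ω : Ω) : ℝ :=
  ∑ r ∈ Finset.Icc 1 R, weight R r * f (euler T b σ x W (r * n) T ω)

end RichardsonRomberg

end

/-! Bias: the weights solve a Vandermonde system, `∑ α_r = 1` and `∑ α_r r^{-k} = 0` for `1 ≤ k <
R`. Writing the weak expansion at each size `r n` and summing with these weights therefore keeps the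
limit, cancels every term `c_k / n^k`, and leaves only `O(n^{-R})` (`sum_weight_div_pow`,
`isBigO_sum_weight_mul_sub`).

Variance: since all schemes use the same `W`, each `f(X̄^{(r)}_T)` tends in `L²` to the same
variable `f(X_T)`. As the weights sum to 1, so does their combination, and the variance is
continuous in `L²`. The `L²` convergence is Vitali's theorem: continuity of `f` gives convergence in
measure, and polynomial growth together with convergence of the schemes in every `L^p` gives uniform
integrability (`HasPolynomialGrowth.tendsto_eLpNorm_comp`). -/

namespace RichardsonRomberg

/-! ### The weights -/

/-- The weights satisfy the Vandermonde system: `∑ α_r r^{-k}` is `1` for `k = 0` and `0` for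
`1 ≤ k ≤ R - 1`. -/
theorem sum_weight_div_pow {R k : ℕ} (hk : k < R) :
    ∑ r ∈ Finset.Icc 1 R, weight R r / (r : ℝ) ^ k = if k = 0 then 1 else 0 := by
  have hfac : (R.factorial : ℝ) ≠ 0 := by positivity
  -- This is the `R`-th forward difference at 0 of `y ^ (R - k)`: it equals `R!` in degree `R` and
  -- vanishes in lower degree.
  have hdiff : ∑ r ∈ Finset.range (R + 1),
      ((-1 : ℝ) ^ (R - r) * R.choose r) * (r : ℝ) ^ (R - k) =
        if k = 0 then (R.factorial : ℝ) else 0 := by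
    have h := fwdDiff_iter_eq_sum_shift (1 : ℝ) (fun y : ℝ => y ^ (R - k)) R 0
    simp only [zero_add, nsmul_eq_mul, mul_one, zsmul_eq_mul] at h
    push_cast at h
    rw [← h]
    split_ifs with h0
    · subst h0
      rw [Nat.sub_zero, fwdDiff_iter_eq_factorial]
      simp
    · rw [fwdDiff_iter_pow_eq_zero_of_lt (by omega)]
      simp
  have hterm : ∀ r ∈ Finset.Icc 1 R, weight R r / (r : ℝ) ^ k =
      ((-1 : ℝ) ^ (R - r) * R.choose r) * (r : ℝ) ^ (R - k) / R.factorial := by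
    intro r hr
    obtain ⟨hr1, hrR⟩ := Finset.mem_Icc.mp hr
    have hr0 : (r : ℝ) ≠ 0 := by positivity
    have hpow : (r : ℝ) ^ R = (r : ℝ) ^ (R - k) * (r : ℝ) ^ k := by
      rw [← pow_add, Nat.sub_add_cancel hk.le]
    rw [weight, Nat.cast_choose ℝ hrR, hpow]
    field_simp
  rw [Finset.sum_congr rfl hterm, ← Finset.sum_div]
  -- The term `r = 0` drops out because `R - k > 0`.
  rw [Finset.sum_range_eq_add_Ico _ (Nat.succ_pos R)] at hdiff
  simp only [Nat.cast_zero, zero_pow (Nat.sub_ne_zero_of_lt hk), mul_zero, zero_add] at hdiff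
  have hIcc : Finset.Ico 1 (R + 1) = Finset.Icc 1 R := by ext; simp
  rw [← hIcc, hdiff]
  split_ifs <;> simp [hfac]

/-! ### Measurability of the Euler scheme -/

theorem measurable_toEuclideanLin_comp {Ω : Type*} {mΩ : MeasurableSpace Ω} {d q : ℕ}
    {A : E d → Matrix (Fin d) (Fin q) ℝ} (hA : Continuous A) {Y : Ω → E d} {Z : Ω → E q}
    (hY : Measurable Y) (hZ : Measurable Z) :
    Measurable (fun ω => Matrix.toEuclideanLin (A (Y ω)) (Z ω)) := by
  have hentry : ∀ i j, Measurable fun ω => A (Y ω) i j := fun i j =>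
    (hA.matrix_elem i j).measurable.comp hY
  have hcoord : ∀ j, Measurable fun ω => Z ω j := fun j =>
    (PiLp.continuous_apply 2 (fun _ : Fin q => ℝ) j).measurable.comp hZ
  have hsum : Measurable fun ω i => ∑ j, A (Y ω) i j * Z ω j :=
    measurable_pi_lambda _ fun i =>
      Finset.measurable_fun_sum _ fun j _ => (hentry i j).mul (hcoord j)
  exact (WithLp.measurable_toLp 2 (Fin d → ℝ)).comp hsum

/-- The restriction `k ≤ m` keeps the grid times in `[0, T]`, where `b` and `σ` are continuous and
`W` is measurable. -/
theorem measurable_eulerGrid {Ω : Type u} {mΩ : MeasurableSpace Ω} {d q : ℕ} {T : ℝ}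
    {b : ℝ → E d → E d} {σ : ℝ → E d → Matrix (Fin d) (Fin q) ℝ}
    (hT : 0 < T) (hb : ContinuousOn (Function.uncurry b) (Set.Icc 0 T ×ˢ Set.univ))
    (hσ : ContinuousOn (Function.uncurry σ) (Set.Icc 0 T ×ˢ Set.univ)) (x : E d)
    {W : ℝ → Ω → E q} (hW : ∀ t ∈ Set.Icc 0 T, Measurable (W t)) {m k : ℕ} (hk : k ≤ m) :
    Measurable (eulerGrid T b σ x m (whiteNoise T W m) k) := by
  induction k with
  | zero => exact measurable_const
  | succ k ih =>
    have hY := ih (by omega)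
    have hm : (0 : ℝ) < m := by exact_mod_cast (by omega : 0 < m)
    have hgrid : ∀ j : ℕ, j ≤ m → (j : ℝ) * T / m ∈ Set.Icc 0 T := fun j hj => by
      refine ⟨by positivity, ?_⟩
      rw [div_le_iff₀ hm, mul_comm]
      gcongr
    have hslice : ContinuousOn (fun y : E d => ((k : ℝ) * T / m, y)) Set.univ := by fun_prop
    have hmaps : Set.MapsTo (fun y : E d => ((k : ℝ) * T / m, y)) Set.univ
        (Set.Icc 0 T ×ˢ Set.univ) := fun y _ => ⟨hgrid k (by omega), trivial⟩
    have hbk : Continuous (b ((k : ℝ) * T / m)) :=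
      continuousOn_univ.mp (hb.comp hslice hmaps)
    have hσk : Continuous (σ ((k : ℝ) * T / m)) :=
      continuousOn_univ.mp (hσ.comp hslice hmaps)
    have hU : Measurable (whiteNoise T W m (k + 1)) := by
      have h1 := hW _ (hgrid (k + 1) hk)
      have h0 := hW _ (hgrid k (by omega))
      unfold whiteNoise
      simp only [Nat.cast_add, Nat.cast_one, add_sub_cancel_right] at h1 ⊢
      exact (h1.sub h0).const_smul (√((m : ℝ) / T))
    have hdrift : Measurable fun ω => (T / m) • b ((k : ℝ) * T / m)
        (eulerGrid T b σ x m (whiteNoise T W m) k ω) :=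
      (hbk.measurable.comp hY).const_smul (T / (m : ℝ))
    have hnoise : Measurable fun ω => √(T / m) • whiteNoise T W m (k + 1) ω :=
      hU.const_smul (√(T / (m : ℝ)))
    simp only [eulerGrid]
    exact (hY.add hdrift).add (measurable_toEuclideanLin_comp hσk hY hnoise)

theorem measurable_euler_terminal {Ω : Type u} {mΩ : MeasurableSpace Ω} {d q : ℕ} {T : ℝ}
    {b : ℝ → E d → E d} {σ : ℝ → E d → Matrix (Fin d) (Fin q) ℝ}
    (hT : 0 < T) (hb : ContinuousOn (Function.uncurry b) (Set.Icc 0 T ×ˢ Set.univ))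
    (hσ : ContinuousOn (Function.uncurry σ) (Set.Icc 0 T ×ˢ Set.univ)) (x : E d)
    {W : ℝ → Ω → E q} (hW : ∀ t ∈ Set.Icc 0 T, Measurable (W t)) (m : ℕ) :
    Measurable (euler T b σ x W m T) := by
  have hfloor : ⌊T * m / T⌋₊ = m := by rw [mul_div_cancel_left₀ _ hT.ne', Nat.floor_natCast]
  unfold euler
  rw [hfloor]
  exact measurable_eulerGrid hT hb hσ x hW le_rfl

theorem IsStrongSolution.aestronglyMeasurable {Ω : Type u} {mΩ : MeasurableSpace Ω} {d q : ℕ}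
    {T : ℝ} {F : Filtration ℝ mΩ} {W : ℝ → Ω → E q} {μ : Measure Ω}
    {b : ℝ → E d → E d} {σ : ℝ → E d → Matrix (Fin d) (Fin q) ℝ} {x : E d} {X : ℝ → Ω → E d}
    (hX : IsStrongSolution T F W μ b σ x X) (hW : ∀ t ∈ Set.Icc 0 T, Measurable (W t))
    {t : ℝ} (ht : t ∈ Set.Icc 0 T) : AEStronglyMeasurable (X t) μ :=
  (hX.adapted t ht).mono <| iSup₂_le fun s hs => (hW s ⟨hs.1, hs.2.trans ht.2⟩).comap_le

/-! ### Convergence in `L^p` -/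

/-- A bound by a pure power of an affine function of `‖y‖` lets `L^p` estimates of `f ∘ Y` be read
off from `L^{pm}` estimates of `C * (1 + ‖Y‖)`. -/
theorem HasPolynomialGrowth.exists_norm_le_pow {d : ℕ} {f : E d → ℝ}
    (hf : HasPolynomialGrowth f) :
    ∃ (C : ℝ) (m : ℕ), 0 ≤ C ∧ 0 < m ∧ ∀ y, ‖f y‖ ≤ (C * (1 + ‖y‖)) ^ m := by
  obtain ⟨C, m, h⟩ := hf
  -- A constant at least 1 is bounded by its own powers, so it can move inside the power; `m + 1`
  -- makes the exponent positive.
  refine ⟨2 * max C 1, m + 1, by positivity, by omega, fun y => (h y).trans ?_⟩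
  have hC : 1 ≤ max C 1 := le_max_right _ _
  have hy : (1 : ℝ) ≤ 1 + ‖y‖ := by linarith [norm_nonneg y]
  have h1 : 1 + ‖y‖ ^ m ≤ 2 * (1 + ‖y‖) ^ (m + 1) := by
    have e1 : (1 + ‖y‖) ^ m ≤ (1 + ‖y‖) ^ (m + 1) := pow_le_pow_right₀ hy (by omega)
    have e2 : ‖y‖ ^ m ≤ (1 + ‖y‖) ^ m := by gcongr; linarith
    have e3 : 1 ≤ (1 + ‖y‖) ^ m := one_le_pow₀ hy
    linarith
  calc C * (1 + ‖y‖ ^ m) ≤ max C 1 * (2 * (1 + ‖y‖) ^ (m + 1)) := by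
        gcongr; exact le_max_left _ _
    _ = (2 * max C 1) ^ 1 * (1 + ‖y‖) ^ (m + 1) := by ring
    _ ≤ (2 * max C 1) ^ (m + 1) * (1 + ‖y‖) ^ (m + 1) := by
        gcongr
        · linarith
        · omega
    _ = _ := (mul_pow _ _ _).symm

section Lp

variable {Ω : Type*} {mΩ : MeasurableSpace Ω} {μ : Measure Ω}

theorem eLpNorm_le_eLpNorm_pow {g Z : Ω → ℝ} {m : ℕ} (hm : 0 < m) (p : ℝ≥0∞)
    (h : ∀ ω, ‖g ω‖ ≤ ‖Z ω‖ ^ m) :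
    eLpNorm g p μ ≤ eLpNorm Z (p * m) μ ^ m := by
  have hZ := eLpNorm_norm_rpow (p := p) (μ := μ) Z (q := (m : ℝ)) (by exact_mod_cast hm)
  simp only [Real.rpow_natCast, ENNReal.rpow_natCast, ENNReal.ofReal_natCast] at hZ
  rw [← hZ]
  exact eLpNorm_mono_real h

theorem unifIntegrable_of_norm_le_pow {ι : Type*} {g Z : ι → Ω → ℝ} {m : ℕ} (hm : 0 < m)
    {p : ℝ≥0∞} (hZ : UnifIntegrable Z (p * m) μ) (h : ∀ i ω, ‖g i ω‖ ≤ ‖Z i ω‖ ^ m) :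
    UnifIntegrable g p μ := by
  intro ε hε
  -- The `m`-th root offsets the `m`-th power in `eLpNorm_le_eLpNorm_pow`.
  obtain ⟨δ, hδ, hs⟩ := hZ (ε := ε ^ (m : ℝ)⁻¹) (by positivity)
  refine ⟨δ, hδ, fun i s hsm hsμ => ?_⟩
  calc eLpNorm (s.indicator (g i)) p μ ≤ eLpNorm (s.indicator (Z i)) (p * m) μ ^ m := by
        refine eLpNorm_le_eLpNorm_pow hm p fun ω => ?_
        by_cases hω : ω ∈ s
        · simpa [hω] using h i ω
        · simp [hω, hm.ne']
    _ ≤ ENNReal.ofReal (ε ^ (m : ℝ)⁻¹) ^ m := by gcongr; exact hs i s hsm hsμ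
    _ = ENNReal.ofReal ε := by
        rw [← ENNReal.ofReal_pow (by positivity), Real.rpow_inv_natCast_pow hε.le hm.ne']

/-- On a finite measure space, convergence in measure means that every subsequence has a further one
converging almost everywhere, a property that continuous maps preserve without uniform continuity.
-/
theorem tendstoInMeasure_continuous_comp [IsFiniteMeasure μ] {G H : Type*}
    [PseudoEMetricSpace G] [PseudoEMetricSpace H] {Y : ℕ → Ω → G} {X : Ω → G}
    (hY : ∀ n, AEStronglyMeasurable (Y n) μ) (hYX : TendstoInMeasure μ Y atTop X)
    {f : G → H} (hf : Continuous f) :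
    TendstoInMeasure μ (fun n ω => f (Y n ω)) atTop (fun ω => f (X ω)) := by
  refine (exists_seq_tendstoInMeasure_atTop_iff
    fun n => hf.comp_aestronglyMeasurable (hY n)).mpr fun ns hns => ?_
  obtain ⟨ns', hns', h⟩ := (hYX.comp hns.tendsto_atTop).exists_seq_tendsto_ae
  exact ⟨ns', hns', h.mono fun ω hω => (hf.tendsto _).comp hω⟩

/-- If `Y n → X` in every `L^p`, then `f ∘ Y n → f ∘ X` in every `L^p`, for `f` continuous with
polynomial growth. -/
theorem HasPolynomialGrowth.tendsto_eLpNorm_comp [IsProbabilityMeasure μ] {d : ℕ} {f : E d → ℝ}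
    (hgrowth : HasPolynomialGrowth f) (hcont : Continuous f) {Y : ℕ → Ω → E d} {X : Ω → E d}
    (hY : ∀ n, AEStronglyMeasurable (Y n) μ)
    (hX : ∀ p : ℝ≥0∞, 1 ≤ p → p < ∞ → MemLp X p μ)
    (hYX : ∀ p : ℝ≥0∞, 1 ≤ p → p < ∞ → Tendsto (fun n => eLpNorm (Y n - X) p μ) atTop (𝓝 0))
    {p : ℝ≥0∞} (hp1 : 1 ≤ p) (hp : p < ∞) :
    MemLp (fun ω => f (X ω)) p μ ∧ (∀ᶠ n in atTop, MemLp (fun ω => f (Y n ω)) p μ) ∧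
      Tendsto (fun n => eLpNorm ((fun ω => f (Y n ω)) - fun ω => f (X ω)) p μ) atTop (𝓝 0) := by
  obtain ⟨C, m, hC, hm, hle⟩ := hgrowth.exists_norm_le_pow
  have hq1 : 1 ≤ p * m := one_le_mul hp1 (by exact_mod_cast hm)
  have hq : p * m < ∞ := ENNReal.mul_lt_top hp (ENNReal.natCast_lt_top m)
  have hle' : ∀ y, ‖f y‖ ≤ ‖C * (1 + ‖y‖)‖ ^ m := fun y => by
    rw [Real.norm_of_nonneg (r := C * (1 + ‖y‖)) (by positivity)]
    exact hle y
  have hbound : ∀ {Z : Ω → E d}, MemLp Z (p * m) μ → MemLp (fun ω => C * (1 + ‖Z ω‖)) (p * m) μ :=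
    fun hZ => ((memLp_const (1 : ℝ)).add hZ.norm).const_mul C
  have hcomp : ∀ {Z : Ω → E d}, MemLp Z (p * m) μ → MemLp (fun ω => f (Z ω)) p μ := fun hZ =>
    ⟨hcont.comp_aestronglyMeasurable hZ.1,
      (eLpNorm_le_eLpNorm_pow hm p fun ω => hle' _).trans_lt
        (ENNReal.pow_lt_top (hbound hZ).2)⟩
  obtain ⟨N, hN⟩ : ∃ N, ∀ n ≥ N, MemLp (Y n) (p * m) μ := by
    refine eventually_atTop.mp (((hYX _ hq1 hq).eventually_lt_const zero_lt_one).mono fun n hn => ?_)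
    have h : MemLp (Y n - X) (p * m) μ :=
      ⟨(hY n).sub (hX _ hq1 hq).1, hn.trans ENNReal.one_lt_top⟩
    simpa using h.add (hX _ hq1 hq)
  refine ⟨hcomp (hX _ hq1 hq), eventually_atTop.mpr ⟨N, fun n hn => hcomp (hN n hn)⟩, ?_⟩
  -- Membership in `L^{pm}` is known only from `N` on, whereas uniform integrability concerns the
  -- whole family; hence the shift.
  rw [← tendsto_add_atTop_iff_nat N]
  refine tendsto_Lp_finite_of_tendstoInMeasure (f := fun n ω => f (Y (n + N) ω)) hp1 hp.ne
    (fun n => hcont.comp_aestronglyMeasurable (hY _)) (hcomp (hX _ hq1 hq)) ?_ ?_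
  · refine unifIntegrable_of_norm_le_pow (Z := fun n ω => C * (1 + ‖Y (n + N) ω‖)) hm ?_
      fun n ω => hle' _
    -- The dominating functions converge in `L^{pm}`, because `|‖Y‖ - ‖X‖| ≤ ‖Y - X‖`, and are
    -- therefore uniformly integrable.
    refine unifIntegrable_of_tendsto_Lp (g := fun ω => C * (1 + ‖X ω‖)) hq1 hq.ne
      (fun n => hbound (hN _ (by omega))) (hbound (hX _ hq1 hq)) ?_
    have hlim : Tendsto (fun n => ENNReal.ofReal C * eLpNorm (Y (n + N) - X) (p * m) μ) atTop
        (𝓝 0) := by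
      simpa using ENNReal.Tendsto.const_mul ((tendsto_add_atTop_iff_nat N).mpr (hYX _ hq1 hq))
        (Or.inr ENNReal.ofReal_ne_top)
    refine tendsto_of_tendsto_of_tendsto_of_le_of_le tendsto_const_nhds hlim
      (fun _ => zero_le) fun n => ?_
    refine eLpNorm_le_mul_eLpNorm_of_ae_le_mul (ae_of_all _ fun ω => ?_) _
    simp only [Pi.sub_apply]
    rw [← mul_sub, add_sub_add_left_eq_sub, norm_mul, Real.norm_of_nonneg hC]
    gcongr
    exact abs_norm_sub_norm_le _ _
  · exact (tendstoInMeasure_continuous_comp hY (tendstoInMeasure_of_tendsto_eLpNorm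
      one_ne_zero hY (hX 1 le_rfl ENNReal.one_lt_top).1
      (hYX 1 le_rfl ENNReal.one_lt_top)) hcont).comp (tendsto_add_atTop_nat N)

/-- Convergence in `L²` implies convergence of the variances. -/
theorem tendsto_variance_of_tendsto_eLpNorm_two [IsProbabilityMeasure μ] {ι : Type*}
    {l : Filter ι} {S : ι → Ω → ℝ} {Z : Ω → ℝ} (hZ : MemLp Z 2 μ)
    (hS : ∀ᶠ i in l, MemLp (S i) 2 μ)
    (hSZ : Tendsto (fun i => eLpNorm (S i - Z) 2 μ) l (𝓝 0)) :
    Tendsto (fun i => variance (S i) μ) l (𝓝 (variance Z μ)) := by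
  have hmean : Tendsto (fun i => ∫ ω, S i ω ∂μ) l (𝓝 (∫ ω, Z ω ∂μ)) := by
    refine tendsto_integral_of_L1' Z hZ.1 (hS.mono fun i hi => hi.integrable one_le_two) ?_
    refine tendsto_of_tendsto_of_tendsto_of_le_of_le' tendsto_const_nhds hSZ
      (Eventually.of_forall fun _ => zero_le) (hS.mono fun i hi => ?_)
    exact eLpNorm_le_eLpNorm_of_exponent_le one_le_two (hi.1.sub hZ.1)
  have hsq : Tendsto (fun i => ∫ ω, (S i ^ 2) ω ∂μ) l (𝓝 (∫ ω, (Z ^ 2) ω ∂μ)) := by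
    refine tendsto_integral_of_L1' (Z ^ 2) (hZ.1.pow 2) (hS.mono fun i hi => hi.integrable_sq) ?_
    -- Bound from `S² - Z² = (S - Z)((S - Z) + 2Z)` and Hölder's inequality; only `S - Z` varies, so
    -- no separate bound on `S` is needed.
    have hlim : Tendsto (fun i => eLpNorm (S i - Z) 2 μ *
        (eLpNorm (S i - Z) 2 μ + eLpNorm (Z + Z) 2 μ)) l (𝓝 0) := by
      have := ENNReal.Tendsto.mul hSZ (Or.inr (by simpa using (hZ.add hZ).2.ne))
        (hSZ.add_const (eLpNorm (Z + Z) 2 μ)) (Or.inr ENNReal.zero_ne_top)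
      simpa using this
    refine tendsto_of_tendsto_of_tendsto_of_le_of_le' tendsto_const_nhds hlim
      (Eventually.of_forall fun _ => zero_le) (hS.mono fun i hi => ?_)
    have hD := hi.sub hZ
    have hfac : S i ^ 2 - Z ^ 2 = (S i - Z) • ((S i - Z) + (Z + Z)) := by
      ext ω
      simp only [Pi.sub_apply, Pi.pow_apply, Pi.smul_apply', Pi.add_apply, smul_eq_mul]
      ring
    rw [hfac]
    refine (eLpNorm_smul_le_mul_eLpNorm (p := 2) (q := 2) (r := 1)
      (hD.1.add (hZ.add hZ).1) hD.1).trans ?_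
    gcongr
    exact eLpNorm_add_le hD.1 (hZ.add hZ).1 one_le_two
  rw [variance_eq_sub hZ]
  exact (hsq.sub (hmean.pow 2)).congr' (hS.mono fun i hi => (variance_eq_sub hi).symm)

end Lp

/-! ### The extrapolated estimator -/

theorem TendstoLpSup.memLp {Ω : Type u} {mΩ : MeasurableSpace Ω} {d : ℕ} {T : ℝ} {μ : Measure Ω}
    {p : ℝ≥0∞} {Y : ℕ → ℝ → Ω → E d} {X : ℝ → Ω → E d} (h : TendstoLpSup T μ p Y X)
    {t : ℝ} (ht : t ∈ Set.Icc 0 T) (hX : AEStronglyMeasurable (X t) μ) : MemLp (X t) p μ :=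
  ⟨hX, (eLpNorm_mono_enorm fun ω => by
    simpa only [enorm_eq_self] using le_iSup₂_of_le (f := fun t _ => ‖X t ω‖ₑ) t ht le_rfl).trans_lt
      h.1⟩

theorem TendstoLpSup.tendsto_eLpNorm {Ω : Type u} {mΩ : MeasurableSpace Ω} {d : ℕ} {T : ℝ}
    {μ : Measure Ω} {p : ℝ≥0∞} {Y : ℕ → ℝ → Ω → E d} {X : ℝ → Ω → E d}
    (h : TendstoLpSup T μ p Y X) {t : ℝ} (ht : t ∈ Set.Icc 0 T) :
    Tendsto (fun n => eLpNorm (Y n t - X t) p μ) atTop (𝓝 0) :=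
  tendsto_of_tendsto_of_tendsto_of_le_of_le tendsto_const_nhds h.2 (fun _ => zero_le) fun n =>
    eLpNorm_mono_enorm fun ω => by
      simpa only [enorm_eq_self, Pi.sub_apply] using
        le_iSup₂_of_le (f := fun t _ => ‖Y n t ω - X t ω‖ₑ) t ht le_rfl

/-- Richardson–Romberg extrapolation of a sequence with an expansion of order `R`. -/
theorem isBigO_sum_weight_mul_sub {R : ℕ} (hR : 1 ≤ R) {a : ℕ → ℝ} {l : ℝ} {c : ℕ → ℝ}
    (h : (fun n : ℕ => l - a n - ∑ k ∈ Finset.Icc 1 (R - 1), c k / (n : ℝ) ^ k)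
      =O[atTop] fun n : ℕ => ((n : ℝ) ^ R)⁻¹) :
    (fun n : ℕ => ∑ r ∈ Finset.Icc 1 R, weight R r * a (r * n) - l)
      =O[atTop] fun n : ℕ => ((n : ℝ) ^ R)⁻¹ := by
  set e : ℕ → ℝ := fun n => l - a n - ∑ k ∈ Finset.Icc 1 (R - 1), c k / (n : ℝ) ^ k with he
  have hsum : ∀ n : ℕ, ∑ r ∈ Finset.Icc 1 R, weight R r * a (r * n) - l =
      -∑ r ∈ Finset.Icc 1 R, weight R r * e (r * n) := by
    intro n
    have hone : ∑ r ∈ Finset.Icc 1 R, weight R r = 1 := by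
      simpa using sum_weight_div_pow (R := R) (k := 0) (by omega)
    have hzero : ∑ r ∈ Finset.Icc 1 R,
        weight R r * ∑ k ∈ Finset.Icc 1 (R - 1), c k / ((r * n : ℕ) : ℝ) ^ k = 0 := by
      simp_rw [Finset.mul_sum]
      rw [Finset.sum_comm]
      -- For each fixed `k`, the factor `c_k / n^k` comes out and the Vandermonde relation kills the
      -- sum over `r`.
      refine Finset.sum_eq_zero fun k hk => ?_
      obtain ⟨hk1, hk2⟩ := Finset.mem_Icc.mp hk
      have := sum_weight_div_pow (R := R) (k := k) (by omega)
      rw [if_neg (by omega)] at this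
      calc _ = c k / (n : ℝ) ^ k * ∑ r ∈ Finset.Icc 1 R, weight R r / (r : ℝ) ^ k := by
            rw [Finset.mul_sum]
            refine Finset.sum_congr rfl fun r _ => ?_
            rw [Nat.cast_mul, mul_pow, div_mul_div_comm, mul_div_assoc', mul_comm (c k),
              mul_comm ((r : ℝ) ^ k)]
        _ = 0 := by rw [this, mul_zero]
    simp only [he, mul_sub, Finset.sum_sub_distrib, ← Finset.sum_mul, hone, one_mul]
    rw [hzero]
    ring
  simp_rw [hsum]
  refine IsBigO.neg_left (IsBigO.fun_sum fun r hr => ?_)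
  refine IsBigO.const_mul_left ?_ (weight R r)
  have hr1 : 1 ≤ r := (Finset.mem_Icc.mp hr).1
  have hmul : Tendsto (fun n : ℕ => r * n) atTop atTop :=
    tendsto_id.const_mul_atTop' (by omega)
  -- The remainder at `r n` is `O((r n)^{-R})`, which is at most `O(n^{-R})` since `r ≥ 1`.
  refine (h.comp_tendsto hmul).trans (isBigO_of_le _ fun n => ?_)
  simp only [Function.comp_apply, norm_inv, norm_pow, Real.norm_natCast]
  rcases Nat.eq_zero_or_pos n with rfl | hn
  · simp
  · gcongr
    exact Nat.le_mul_of_pos_left n (by omega)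

end RichardsonRomberg

theorem proposition1 {Ω : Type u} {mΩ : MeasurableSpace Ω} (μ : Measure Ω) [IsProbabilityMeasure μ]
    {d q : ℕ} (T : ℝ) (hT : 0 < T)
    (b : ℝ → RichardsonRomberg.E d → RichardsonRomberg.E d)
    (σ : ℝ → RichardsonRomberg.E d → Matrix (Fin d) (Fin q) ℝ)
    (hb : ContinuousOn (Function.uncurry b) (Set.Icc 0 T ×ˢ Set.univ))
    (hσ : ContinuousOn (Function.uncurry σ) (Set.Icc 0 T ×ˢ Set.univ))
    (x : RichardsonRomberg.E d)
    (F : Filtration ℝ mΩ) (W : ℝ → Ω → RichardsonRomberg.E q)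
    (hW : RichardsonRomberg.IsBrownianMotion T F W μ)
    (X : ℝ → Ω → RichardsonRomberg.E d)
    (hX : RichardsonRomberg.IsStrongSolution T F W μ b σ x X)
    (hLp : ∀ p : ℝ≥0∞, 1 ≤ p → p < ∞ →
      RichardsonRomberg.TendstoLpSup T μ p (fun n => RichardsonRomberg.euler T b σ x W n) X)
    (V : Submodule ℝ (RichardsonRomberg.E d → ℝ))
    (hVchar : RichardsonRomberg.IsCharacterizing.{u} V)
    (hVcont : ∀ f ∈ V, Continuous f)
    (hVgrowth : ∀ f ∈ V, RichardsonRomberg.HasPolynomialGrowth f)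
    (hVmul : ∀ f ∈ V, ∀ g ∈ V, f * g ∈ V)
    (R : ℕ) (hR : 1 ≤ R)
    (hE : RichardsonRomberg.HasWeakExpansion μ V R
      (fun n => RichardsonRomberg.euler T b σ x W n T) (X T))
    (f : RichardsonRomberg.E d → ℝ) (hf : f ∈ V) :
    MemLp (fun ω => f (X T ω)) 2 μ ∧
    (∀ r ∈ Finset.Icc 1 R,
      ∀ᶠ n : ℕ in atTop, MemLp (fun ω => f (RichardsonRomberg.euler T b σ x W (r * n) T ω)) 2 μ) ∧
    ((fun n : ℕ => (∫ ω, RichardsonRomberg.multistep T b σ x W R f n ω ∂μ) - ∫ ω, f (X T ω) ∂μ)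
      =O[atTop] fun n : ℕ => ((n : ℝ) ^ R)⁻¹) ∧
    Tendsto (fun n : ℕ => variance (RichardsonRomberg.multistep T b σ x W R f n) μ) atTop
      (𝓝 (variance (fun ω => f (X T ω)) μ)) := by
  have hWm : ∀ t ∈ Set.Icc 0 T, Measurable (W t) := fun t ht =>
    (hW.adapted t ht).mono (F.le t) le_rfl
  have hTmem : T ∈ Set.Icc 0 T := ⟨hT.le, le_rfl⟩
  have hXm := hX.aestronglyMeasurable hWm hTmem
  obtain ⟨hfX, hfY, hlim⟩ := (hVgrowth f hf).tendsto_eLpNorm_comp (hVcont f hf)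
    (fun n => (RichardsonRomberg.measurable_euler_terminal hT hb hσ x hWm n).aestronglyMeasurable)
    (fun p hp1 hp => (hLp p hp1 hp).memLp hTmem hXm)
    (fun p hp1 hp => (hLp p hp1 hp).tendsto_eLpNorm hTmem) one_le_two ENNReal.ofNat_lt_top
  have hmul : ∀ r ∈ Finset.Icc 1 R, Tendsto (fun n : ℕ => r * n) atTop atTop := fun r hr =>
    tendsto_id.const_mul_atTop' (by have := (Finset.mem_Icc.mp hr).1; omega)
  have hmem : ∀ r ∈ Finset.Icc 1 R, ∀ᶠ n : ℕ in atTop,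
      MemLp (fun ω => f (RichardsonRomberg.euler T b σ x W (r * n) T ω)) 2 μ :=
    fun r hr => (hmul r hr).eventually hfY
  have hall := (Finset.eventually_all (Finset.Icc 1 R)).mpr hmem
  refine ⟨hfX, hmem, ?_, ?_⟩
  · obtain ⟨c, hc⟩ := hE f hf
    refine (RichardsonRomberg.isBigO_sum_weight_mul_sub hR hc).congr' (hall.mono fun n hn => ?_)
      EventuallyEq.rfl
    simp only [RichardsonRomberg.multistep]
    rw [integral_finsetSum _ fun r hr => ((hn r hr).integrable one_le_two).const_mul _]
    simp only [integral_const_mul]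
  · refine RichardsonRomberg.tendsto_variance_of_tendsto_eLpNorm_two hfX (hall.mono fun n hn =>
      memLp_finsetSum _ fun r hr => (hn r hr).const_mul _) ?_
    have hone : ∑ r ∈ Finset.Icc 1 R, RichardsonRomberg.weight R r = 1 := by
      simpa using RichardsonRomberg.sum_weight_div_pow (R := R) (k := 0) (by omega)
    have hbound : Tendsto (fun n : ℕ => ∑ r ∈ Finset.Icc 1 R, ‖RichardsonRomberg.weight R r‖ₑ *
        eLpNorm ((fun ω => f (RichardsonRomberg.euler T b σ x W (r * n) T ω)) -
          fun ω => f (X T ω)) 2 μ) atTop (𝓝 0) := by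
      have hzero : (0 : ℝ≥0∞) = ∑ r ∈ Finset.Icc 1 R, 0 := Finset.sum_const_zero.symm
      conv => rhs; rw [hzero]
      refine tendsto_finsetSum _ fun r hr => ?_
      simpa using ENNReal.Tendsto.const_mul (hlim.comp (hmul r hr)) (Or.inr enorm_ne_top)
    refine tendsto_of_tendsto_of_tendsto_of_le_of_le' tendsto_const_nhds hbound
      (Eventually.of_forall fun _ => zero_le) (hall.mono fun n hn => ?_)
    -- As the weights sum to 1, the error of the combination is the weighted sum of the individual
    -- errors, and Minkowski's inequality applies.
    have hdecomp : RichardsonRomberg.multistep T b σ x W R f n - (fun ω => f (X T ω)) =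
        ∑ r ∈ Finset.Icc 1 R, RichardsonRomberg.weight R r •
          ((fun ω => f (RichardsonRomberg.euler T b σ x W (r * n) T ω)) - fun ω => f (X T ω)) := by
      ext ω
      simp only [RichardsonRomberg.multistep, Pi.sub_apply, Finset.sum_apply, Pi.smul_apply,
        smul_eq_mul, mul_sub, Finset.sum_sub_distrib, ← Finset.sum_mul, hone, one_mul]
    rw [hdecomp]
    refine (eLpNorm_sum_le (fun r hr => ((hn r hr).sub hfX).1.const_smul _) one_le_two).trans ?_
    exact Finset.sum_le_sum fun r _ => (eLpNorm_const_smul _ _ _ _).le
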